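/- Let $S$ be a countable set and let $P=(P_{r,s})_{r,s\in S}$ be a stochastic matrix, where $P_{r,s}\in[0,1]$ is the probability of moving from $s$ to $r$ and $\sum_{r\in S}P_{r,s}=1$ for every $s$. Let $X_\bullet=(X_n)_{n\ge 1}$ be an $S$-valued Markov chain on a probability space, with transition matrix $P$ and arbitrary initial distribution, where $X_n$ is the state of the $n$-th job $J_n$ of a real-time task. Let $S_{\mathrm{DM}}\subseteq S$ be the set of states that indicate a deadline miss; that is, the variable $\mathrm{DM}(j)$, equal to $1$ if $J_j$ misses its deadline and to $0$ otherwise, is $1$ exactly when $X_j\in S_{\mathrm{DM}}$. Put $\mathrm{DMR}_N=\frac1N\sum_{j=1}^N\mathrm{DM}(j)$. A real number $\mathrm{DMR}$ is called the deadline miss rate if $\mathbb P(\lim_{N\to\infty}\mathrm{DMR}_N=\mathrm{DMR})=1$. Suppose that $X_\bullet$ is irreducible (every state can be reached from every state along transitions of positive probability) and positive recurrent (for every $s\in S$, the chain with transition matrix $P$ started at $X_1=s$ satisfies $\mathbb E[T_s\mid X_1=s]<\infty$, where $T_s=\inf\{n\ge 2 : X_n=s\}$ and $\inf\emptyset=\infty$).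 Then there is a unique invariant distribution $\pi$, i.e. a unique $\pi=(\pi_s)_{s\in S}$ with $\pi_s\ge 0$, $\sum_{s\in S}\pi_s=1$ and $P\pi=\pi$, and $$\mathbb P\Big(\lim_{N\to\infty}\mathrm{DMR}_N=\sum_{s\in S_{\mathrm{DM}}}\pi_s\Big)=1 .$$ Therefore the deadline miss rate exists and is $\mathrm{DMR}=\sum_{s\in S_{\mathrm{DM}}}\pi_s$. -/

import Mathlib

open MeasureTheory Filter Topology
open scoped ENNReal

namespace DeadlineMiss

/-- A (left, i.e. column-) stochastic matrix on a state space `S`: `P r s` is the probability of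
moving from state `s` to state `r`, and each column sums to `1`. -/
structure StochasticMatrix (S : Type*) where
  /-- the entries -/
  entry : Matrix S S ℝ
  nonneg : ∀ r s, 0 ≤ entry r s
  hasSum_col : ∀ s, HasSum (fun r => entry r s) 1

section Chain

variable {S : Type*}

/-- The `s`-th column of a stochastic matrix, as a probability distribution on `S`:
the law of the next state when the current state is `s`. -/
noncomputable def StochasticMatrix.col (P : StochasticMatrix S) (s : S) : PMF S :=
  ⟨fun r => ENNReal.ofReal (P.entry r s), by
    have h := P.hasSum_col s
    have h2 := ENNReal.ofReal_tsum_of_nonneg (fun r => P.nonneg r s) h.summable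
    rw [h.tsum_eq, ENNReal.ofReal_one] at h2
    rw [h2]
    exact ENNReal.summable.hasSum⟩

/-- `X = (X_n)` is a Markov chain with transition matrix `P` under `μ`. Time is counted from `0`, so
`X 0` is the first state of the chain; its law, the initial distribution, is arbitrary. The
conditional probabilities are required to be the right ones whenever they are defined. -/
structure IsMarkovChain {Ω : Type*} [MeasurableSpace Ω] [MeasurableSpace S]
    (μ : Measure Ω) (X : ℕ → Ω → S) (P : StochasticMatrix S) : Prop where
  measurable : ∀ n, Measurable (X n)
  /-- the Markov property -/
  markov : ∀ (n : ℕ) (x : ℕ → S) (r : S), μ {ω | ∀ i ≤ n, X i ω = x i} ≠ 0 →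
    ProbabilityTheory.cond μ {ω | ∀ i ≤ n, X i ω = x i} {ω | X (n + 1) ω = r} =
      ProbabilityTheory.cond μ {ω | X n ω = x n} {ω | X (n + 1) ω = r}
  /-- the transition probabilities -/
  transition : ∀ (n : ℕ) (s r : S), μ {ω | X n ω = s} ≠ 0 →
    ProbabilityTheory.cond μ {ω | X n ω = s} {ω | X (n + 1) ω = r} =
      ENNReal.ofReal (P.entry r s)

/-- The chain is irreducible: any state can be reached from any state (itself included) along a
nonempty path of transitions of positive probability. -/
def StochasticMatrix.IsIrreducible (P : StochasticMatrix S) : Prop :=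
  ∀ r s : S, Relation.TransGen (fun a b => 0 < P.entry b a) r s

variable [MeasurableSpace S] [DiscreteMeasurableSpace S]

/-- One step of the chain, as a kernel. -/
noncomputable def StochasticMatrix.stepKernel (P : StochasticMatrix S) :
    ProbabilityTheory.Kernel S S where
  toFun s := (P.col s).toMeasure
  measurable' := Measurable.of_discrete

instance (P : StochasticMatrix S) : ProbabilityTheory.IsMarkovKernel P.stepKernel :=
  ⟨fun s => inferInstanceAs (IsProbabilityMeasure (P.col s).toMeasure)⟩

/-- The law of `X_{n+1}` given the history `X_0, …, X_n`. -/
noncomputable def StochasticMatrix.historyKernel (P : StochasticMatrix S) (n : ℕ) :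
    ProbabilityTheory.Kernel (Finset.Iic n → S) S :=
  P.stepKernel.comap (fun x => x ⟨n, Finset.mem_Iic.2 le_rfl⟩) (measurable_pi_apply _)

instance (P : StochasticMatrix S) (n : ℕ) :
    ProbabilityTheory.IsMarkovKernel (P.historyKernel n) :=
  inferInstanceAs (ProbabilityTheory.IsMarkovKernel (P.stepKernel.comap _ _))

/-- The law `ℙ( · | X_0 = s)` of the trajectory of the chain with transition matrix `P` started
at `s`, built by the Ionescu-Tulcea theorem. -/
noncomputable def StochasticMatrix.lawFrom (P : StochasticMatrix S) (s : S) :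
    Measure (ℕ → S) :=
  ProbabilityTheory.Kernel.traj (X := fun _ => S) P.historyKernel 0 (fun _ => s)

end Chain

/-- The first passage time of the state `s` along a trajectory, not counting the initial state;
`∞` if `s` is not visited again. The states `x 0, x 1, …` are numbered `1, 2, …`, so that the
possible finite values are `2, 3, …`. -/
noncomputable def firstPassage {S : Type*} (s : S) (x : ℕ → S) : ℝ≥0∞ :=
  ⨅ (n : ℕ) (_ : 1 ≤ n ∧ x n = s), ((n + 1 : ℕ) : ℝ≥0∞)

/-- The chain is positive recurrent: `𝔼[T_s | X_0 = s] < ∞` for each state `s`, with `T_s` the first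
passage time of `s`. -/
def StochasticMatrix.IsPositiveRecurrent {S : Type*} [MeasurableSpace S]
    [DiscreteMeasurableSpace S] (P : StochasticMatrix S) : Prop :=
  ∀ s : S, ∫⁻ x, firstPassage s x ∂(P.lawFrom s) < ∞

/-- `π` is a stationary (invariant) probability distribution of `P`, i.e. `P π = π`. -/
structure StochasticMatrix.IsStationary {S : Type*} (P : StochasticMatrix S) (π : S → ℝ) :
    Prop where
  nonneg : ∀ s, 0 ≤ π s
  hasSum_one : HasSum π 1
  invariant : ∀ r, HasSum (fun s => P.entry r s * π s) (π r)

section Rate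

variable {Ω : Type*}

/-- The 0-1-valued variable `DM`, where `missed j` is the event that job number `j` (counted
from `0`) misses its deadline. -/
noncomputable def DM (missed : ℕ → Set Ω) (j : ℕ) : Ω → ℝ := (missed j).indicator 1

/-- The deadline miss rate of the first `N` jobs. -/
noncomputable def DMRUpTo (missed : ℕ → Set Ω) (N : ℕ) (ω : Ω) : ℝ :=
  (1 / (N : ℝ)) * ∑ j ∈ Finset.range N, DM missed j ω

/-- The number `d` is the deadline miss rate: the miss rates of the first `N` jobs converge to `d`
almost surely. -/
def IsDeadlineMissRate [MeasurableSpace Ω] (μ : Measure Ω) (missed : ℕ → Set Ω) (d : ℝ) :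
    Prop :=
  ∀ᵐ ω ∂μ, Tendsto (fun N : ℕ => DMRUpTo missed N ω) atTop (𝓝 d)

end Rate

end DeadlineMiss

/-!
Along a chain started at a positive recurrent state `s`, the excursions between successive visits
to `s` are independent and identically distributed, by the strong Markov property. The strong law
of large numbers, applied to the number of visits to a set `A` during an excursion and to the
length of the excursion, shows that the frequency of the visits to `A` is the quotient of the two
means; it is the same from every state that the chain can reach from `s`, because deleting the
first state of a trajectory does not change frequencies. The mean numbers of visits form an
invariant measure. Conversely, the shift preserves the law of the chain started from any invariant
distribution, so the mass of `A` is the mean of the averaged visits to `A`, hence equal to their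
almost sure limit; this determines the distribution.
-/

namespace DeadlineMiss

open ProbabilityTheory

section BirkhoffSum

variable {α : Type*} {T : α → α}

lemma birkhoffAverage_real (g : α → ℝ) (n : ℕ) (x : α) :
    birkhoffAverage ℝ T g n x = birkhoffSum T g n x / n := by
  rw [birkhoffAverage, smul_eq_mul, inv_mul_eq_div]

lemma norm_birkhoffAverage_le {g : α → ℝ} {C : ℝ} (hC : ∀ x, ‖g x‖ ≤ C) (n : ℕ) (x : α) :
    ‖birkhoffAverage ℝ T g n x‖ ≤ C := by
  rcases eq_or_ne n 0 with rfl | hn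
  · simpa using (norm_nonneg _).trans (hC x)
  have hn' : (0 : ℝ) < n := by positivity
  rw [birkhoffAverage_real, norm_div, Real.norm_natCast, div_le_iff₀ hn', mul_comm]
  refine (norm_sum_le_of_le _ fun k _ => hC (T^[k] x)).trans_eq ?_
  rw [Finset.sum_const, Finset.card_range, nsmul_eq_mul]

lemma monotone_birkhoffSum {g : α → ℝ} (hg : 0 ≤ g) (x : α) :
    Monotone fun n => birkhoffSum T g n x :=
  monotone_nat_of_le_succ fun n => by
    rw [birkhoffSum_succ]
    exact le_add_of_nonneg_right (hg _)

end BirkhoffSum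

lemma tendsto_succ_div {u : ℕ → ℝ} {m : ℝ} (hu : Tendsto (fun k : ℕ => u k / k) atTop (𝓝 m)) :
    Tendsto (fun k : ℕ => u (k + 1) / k) atTop (𝓝 m) := by
  have hratio : Tendsto (fun k : ℕ => ((k + 1 : ℕ) : ℝ) / k) atTop (𝓝 1) := by
    simpa using (tendsto_natCast_div_add_atTop (1 : ℝ)).inv₀ one_ne_zero
  refine (((hu.comp (tendsto_add_atTop_nat 1)).mul hratio).congr fun k => ?_).trans_eq
    (by rw [mul_one])
  exact div_mul_div_cancel₀ (Nat.cast_ne_zero.2 k.succ_ne_zero)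

lemma tendsto_div_of_tendsto_div_subseq {u : ℕ → ℝ} (hu : Monotone u) {t : ℕ → ℕ} {m y : ℝ}
    (hm : 0 < m) (ht : Tendsto (fun k : ℕ => (t k : ℝ) / k) atTop (𝓝 m))
    (hy : Tendsto (fun k : ℕ => u (t k) / k) atTop (𝓝 y)) :
    Tendsto (fun n : ℕ => u n / n) atTop (𝓝 (y / m)) := by
  have hpos : ∀ᶠ k : ℕ in atTop, (0 : ℝ) < k :=
    (eventually_gt_atTop 0).mono fun k hk => Nat.cast_pos.2 hk
  have htop : Tendsto (fun k => (t k : ℝ)) atTop atTop := by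
    refine (ht.pos_mul_atTop hm tendsto_natCast_atTop_atTop).congr' ?_
    filter_upwards [hpos] with k hk using div_mul_cancel₀ _ hk.ne'
  refine tendsto_div_of_monotone_of_exists_subseq_tendsto_div u _ hu fun a ha =>
    ⟨t, ?_, tendsto_natCast_atTop_iff.1 htop, ?_⟩
  · have hgap := (tendsto_succ_div ht).sub (ht.const_mul a)
    filter_upwards [hpos, hgap.eventually_lt_const (show m - a * m < 0 by nlinarith)] with k hk hlt
    rw [← mul_div_assoc, ← sub_div, div_lt_iff₀ hk, zero_mul, sub_neg] at hlt
    exact hlt.le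
  · refine (hy.div ht hm.ne').congr' ?_
    filter_upwards [hpos] with k hk using div_div_div_cancel_right₀ hk.ne' _ _

section InducedMap

variable {α : Type*} {T : α → α} {τ : α → ℕ}

/-- The map induced by `T` and a time `τ`, such as a first return time: it moves `x` forward `τ x`
steps. -/
def inducedMap (T : α → α) (τ : α → ℕ) (x : α) : α := T^[τ x] x

/-- The sum of `g` over the piece of the orbit of `x` that `inducedMap T τ` jumps over. -/
def inducedSum {M : Type*} [AddCommMonoid M] (T : α → α) (τ : α → ℕ) (g : α → M) (x : α) : M :=
  birkhoffSum T g (τ x) x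

lemma inducedSum_nonneg {g : α → ℝ} (hg : 0 ≤ g) : 0 ≤ inducedSum T τ g := fun x => by
  rw [inducedSum, birkhoffSum]
  exact Finset.sum_nonneg fun k _ => hg (T^[k] x)

lemma iterate_inducedMap (k : ℕ) (x : α) :
    (inducedMap T τ)^[k] x = T^[birkhoffSum (inducedMap T τ) τ k x] x := by
  induction k with
  | zero => rfl
  | succ k ih =>
    rw [Function.iterate_succ_apply', birkhoffSum_succ, Nat.add_comm, Function.iterate_add_apply,
      ← ih, inducedMap]

lemma birkhoffSum_inducedSum {M : Type*} [AddCommMonoid M] (g : α → M) (k : ℕ) (x : α) :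
    birkhoffSum (inducedMap T τ) (inducedSum T τ g) k x =
      birkhoffSum T g (birkhoffSum (inducedMap T τ) τ k x) x := by
  induction k with
  | zero => rfl
  | succ k ih =>
    rw [birkhoffSum_succ, birkhoffSum_succ _ τ, birkhoffSum_add, ih, ← iterate_inducedMap,
      inducedSum]

lemma tendsto_birkhoffAverage_of_inducedMap {g : α → ℝ} (hg : 0 ≤ g) {x : α} {m y : ℝ}
    (hm : 0 < m)
    (hτ : Tendsto (birkhoffAverage ℝ (inducedMap T τ) (fun x => (τ x : ℝ)) · x) atTop (𝓝 m))
    (hy : Tendsto (birkhoffAverage ℝ (inducedMap T τ) (inducedSum T τ g) · x) atTop (𝓝 y)) :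
    Tendsto (birkhoffAverage ℝ T g · x) atTop (𝓝 (y / m)) := by
  simp only [birkhoffAverage_real, birkhoffSum_inducedSum] at hτ hy ⊢
  refine tendsto_div_of_tendsto_div_subseq (monotone_birkhoffSum hg x) hm (hτ.congr fun k => ?_) hy
  simp only [birkhoffSum, Nat.cast_sum]

end InducedMap

section StationaryAverages

variable {α : Type*} [MeasurableSpace α] {μ : Measure α} {T : α → α}

lemma indepFun_comp_iterate {Z : α → ℝ} (hT : MeasurePreserving T μ μ) (hZ : Measurable Z)
    (hind : IndepFun Z T μ) {i j : ℕ} (hij : i < j) :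
    IndepFun (Z ∘ T^[i]) (Z ∘ T^[j]) μ := by
  obtain ⟨m, rfl⟩ := Nat.exists_eq_add_of_lt hij
  have hsucc : Z ∘ T^[i + m + 1] = (Z ∘ T^[m]) ∘ T ∘ T^[i] := by
    rw [show i + m + 1 = m + 1 + i by omega, Function.iterate_add, Function.iterate_succ]
    rfl
  have hm : Measurable (Z ∘ T^[m]) := hZ.comp (hT.iterate m).measurable
  rw [hsucc, indepFun_iff_measure_inter_preimage_eq_mul]
  intro B C hB hC
  have hTC : MeasurableSet (T ⁻¹' ((Z ∘ T^[m]) ⁻¹' C)) := hT.measurable (hm hC)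
  have hmp := hT.iterate i
  calc μ (T^[i] ⁻¹' (Z ⁻¹' B ∩ T ⁻¹' ((Z ∘ T^[m]) ⁻¹' C)))
      = μ (Z ⁻¹' B ∩ T ⁻¹' ((Z ∘ T^[m]) ⁻¹' C)) :=
        hmp.measure_preimage ((hZ hB).inter hTC).nullMeasurableSet
    _ = μ (Z ⁻¹' B) * μ (T ⁻¹' ((Z ∘ T^[m]) ⁻¹' C)) :=
        hind.measure_inter_preimage_eq_mul _ _ hB (hm hC)
    _ = μ (T^[i] ⁻¹' (Z ⁻¹' B)) * μ (T^[i] ⁻¹' (T ⁻¹' ((Z ∘ T^[m]) ⁻¹' C))) := by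
        rw [hmp.measure_preimage (hZ hB).nullMeasurableSet,
          hmp.measure_preimage hTC.nullMeasurableSet]

lemma strong_law_birkhoffAverage {Z : α → ℝ} (hT : MeasurePreserving T μ μ) (hZ : Measurable Z)
    (hint : Integrable Z μ) (hind : IndepFun Z T μ) :
    ∀ᵐ x ∂μ, Tendsto (birkhoffAverage ℝ T Z · x) atTop (𝓝 (∫ x, Z x ∂μ)) := by
  have hpair : Pairwise fun i j => IndepFun (Z ∘ T^[i]) (Z ∘ T^[j]) μ := by
    intro i j hij
    rcases hij.lt_or_gt with h | h
    · exact indepFun_comp_iterate hT hZ hind h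
    · exact (indepFun_comp_iterate hT hZ hind h).symm
  have hident : ∀ i, IdentDistrib (Z ∘ T^[i]) (Z ∘ T^[0]) μ μ := fun i =>
    ⟨(hZ.comp (hT.iterate i).measurable).aemeasurable, hZ.aemeasurable, by
      rw [← Measure.map_map hZ (hT.iterate i).measurable, (hT.iterate i).map_eq]
      rfl⟩
  filter_upwards [strong_law_ae_real (fun i => Z ∘ T^[i]) hint hpair hident]
    with x hx
  exact hx.congr fun n => (birkhoffAverage_real Z n x).symm

lemma measurable_birkhoffAverage {g : α → ℝ} (hT : Measurable T) (hg : Measurable g) (n : ℕ) :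
    Measurable (birkhoffAverage ℝ T g n) :=
  (Finset.measurable_sum _ fun k _ => hg.comp (hT.iterate k)).const_smul ((n : ℝ)⁻¹)

lemma integral_birkhoffAverage (hT : MeasurePreserving T μ μ) {g : α → ℝ} (hg : Integrable g μ)
    {n : ℕ} (hn : n ≠ 0) : ∫ x, birkhoffAverage ℝ T g n x ∂μ = ∫ x, g x ∂μ := by
  have hterm : ∀ k : ℕ, ∫ x, g (T^[k] x) ∂μ = ∫ x, g x ∂μ := fun k => by
    have hmap := (hT.iterate k).map_eq
    rw [← integral_map (hT.iterate k).measurable.aemeasurable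
      (hmap.symm ▸ hg.aestronglyMeasurable), hmap]
  simp only [birkhoffAverage_real, birkhoffSum]
  rw [integral_div, integral_finsetSum (f := fun k x => g (T^[k] x)) _
    fun k _ => (hT.iterate k).integrable_comp_of_integrable hg]
  simp only [hterm, Finset.sum_const, Finset.card_range, nsmul_eq_mul]
  exact mul_div_cancel_left₀ _ (Nat.cast_ne_zero.2 hn)

lemma integral_eq_of_ae_tendsto_birkhoffAverage [IsProbabilityMeasure μ]
    (hT : MeasurePreserving T μ μ) {g : α → ℝ} (hg : Measurable g) {C c : ℝ}
    (hC : ∀ x, ‖g x‖ ≤ C)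
    (h : ∀ᵐ x ∂μ, Tendsto (birkhoffAverage ℝ T g · x) atTop (𝓝 c)) : ∫ x, g x ∂μ = c := by
  have hint : Integrable g μ := .of_bound hg.aestronglyMeasurable C (ae_of_all _ hC)
  have hlim := tendsto_integral_of_dominated_convergence (fun _ => C)
    (fun n => (measurable_birkhoffAverage hT.measurable hg n).aestronglyMeasurable)
    (integrable_const C) (fun n => ae_of_all _ (norm_birkhoffAverage_le hC n)) h
  rw [integral_const, probReal_univ, one_smul] at hlim
  refine tendsto_nhds_unique (tendsto_const_nhds.congr' ?_) hlim
  filter_upwards [eventually_ne_atTop 0] with n hn using (integral_birkhoffAverage hT hint hn).symm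

end StationaryAverages

section CountableFibers

variable {α β γ : Type*} [MeasurableSpace α] [MeasurableSpace β] [MeasurableSpace γ] [Countable β]
  [MeasurableSingletonClass β] {f : α → β}

lemma tsum_measure_inter_preimage_singleton (μ : Measure α) {E : Set α} (hE : MeasurableSet E)
    (hf : Measurable f) : ∑' b, μ (E ∩ f ⁻¹' {b}) = μ E := by
  have h := tsum_measure_preimage_singleton (μ := μ.restrict E) Set.countable_univ
    fun b _ => hf (measurableSet_singleton b)
  rw [tsum_univ (f := fun b => μ.restrict E (f ⁻¹' {b})), Set.preimage_univ,
    Measure.restrict_apply_univ] at h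
  simpa only [Measure.restrict_apply' hE, Set.inter_comm E] using h

lemma measurable_apply_of_countable (hf : Measurable f) {g : β → α → γ}
    (hg : ∀ b, Measurable (g b)) : Measurable fun x => g (f x) x := by
  intro B hB
  have hunion : (fun x => g (f x) x) ⁻¹' B = ⋃ b, f ⁻¹' {b} ∩ g b ⁻¹' B := by
    ext x
    simp
  rw [hunion]
  exact .iUnion fun b => (hf (measurableSet_singleton b)).inter (hg b hB)

end CountableFibers

section PathSpace

variable {S : Type*}

/-- The left shift on trajectories, which forgets the first state. -/
def shift (x : ℕ → S) : ℕ → S := fun j => x (j + 1)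

lemma iterate_shift_apply (n : ℕ) (x : ℕ → S) (j : ℕ) : shift^[n] x j = x (j + n) := by
  induction n generalizing x with
  | zero => rfl
  | succ n ih =>
    rw [Function.iterate_succ_apply, ih, shift, Nat.add_assoc]

lemma cylinder_succ_eq_preimage (a : ℕ → S) (n : ℕ) :
    PiNat.cylinder a (n + 1) =
      Preorder.frestrictLe (π := fun _ => S) n ⁻¹' {Preorder.frestrictLe n a} := by
  ext x
  simp [funext_iff]

lemma cylinder_succ_eq_inter (a : ℕ → S) (n : ℕ) :
    PiNat.cylinder a (n + 1) = PiNat.cylinder a n ∩ {x | x n = a n} := by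
  ext x
  exact Nat.forall_lt_succ_right

lemma dependsOn_cylinder (a : ℕ → S) (n : ℕ) :
    DependsOn (· ∈ PiNat.cylinder a (n + 1)) (Set.Iic n) := fun x y hxy => by
  simp only [PiNat.mem_cylinder_iff, Nat.lt_succ_iff]
  exact propext (forall₂_congr fun i hi => by rw [hxy i hi])

lemma preimage_image_frestrictLe {D : Set (ℕ → S)} {n : ℕ}
    (hD : DependsOn (· ∈ D) (Set.Iic n)) :
    Preorder.frestrictLe (π := fun _ => S) n ⁻¹' (Preorder.frestrictLe n '' D) = D := by
  refine Set.Subset.antisymm (fun x ⟨y, hy, hyx⟩ => ?_) (Set.subset_preimage_image _ _)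
  have hxy : ∀ i ∈ Set.Iic n, y i = x i := fun i hi =>
    congrFun hyx ⟨i, Finset.mem_Iic.2 hi⟩
  exact (hD hxy).mp hy

variable [MeasurableSpace S]

lemma measurable_shift : Measurable (shift : (ℕ → S) → ℕ → S) :=
  measurable_pi_lambda _ fun _ => measurable_pi_apply _

variable [DiscreteMeasurableSpace S]

lemma measurableSet_eval_mem (n : ℕ) (A : Set S) : MeasurableSet {x : ℕ → S | x n ∈ A} :=
  measurable_pi_apply n (.of_discrete (s := A))

variable [Countable S]

lemma measurableSet_of_dependsOn {D : Set (ℕ → S)} {n : ℕ}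
    (hD : DependsOn (· ∈ D) (Set.Iic n)) : MeasurableSet D := by
  rw [← preimage_image_frestrictLe hD]
  exact Preorder.measurable_frestrictLe n .of_discrete

lemma measurableSet_cylinder (a : ℕ → S) (n : ℕ) : MeasurableSet (PiNat.cylinder a (n + 1)) :=
  measurableSet_of_dependsOn (dependsOn_cylinder a n)

variable {m m' : Measure (ℕ → S)}

lemma map_frestrictLe_eq_of_cylinder {n : ℕ}
    (h : ∀ a, m (PiNat.cylinder a (n + 1)) = m' (PiNat.cylinder a (n + 1))) :
    m.map (Preorder.frestrictLe (π := fun _ => S) n) = m'.map (Preorder.frestrictLe n) := by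
  rcases isEmpty_or_nonempty (ℕ → S) with hS | ⟨⟨b⟩⟩
  · rw [m.eq_zero_of_isEmpty, m'.eq_zero_of_isEmpty]
  refine Measure.ext_of_singleton fun p => ?_
  obtain ⟨a, rfl⟩ : ∃ a : ℕ → S, Preorder.frestrictLe n a = p :=
    ⟨fun i => if hi : i ≤ n then p ⟨i, Finset.mem_Iic.2 hi⟩ else b i,
      funext fun ⟨i, hi⟩ => dif_pos (Finset.mem_Iic.1 hi)⟩
  rw [Measure.map_apply (by fun_prop) (measurableSet_singleton _),
    Measure.map_apply (by fun_prop) (measurableSet_singleton _), ← cylinder_succ_eq_preimage, h]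

lemma measure_eq_of_cylinder {n : ℕ}
    (h : ∀ a, m (PiNat.cylinder a (n + 1)) = m' (PiNat.cylinder a (n + 1))) {D : Set (ℕ → S)}
    (hD : DependsOn (· ∈ D) (Set.Iic n)) : m D = m' D := by
  have hD' := congrArg (fun ν => ν (Preorder.frestrictLe n '' D)) (map_frestrictLe_eq_of_cylinder h)
  simp only [Measure.map_apply (Preorder.measurable_frestrictLe n) MeasurableSet.of_discrete] at hD'
  rwa [preimage_image_frestrictLe hD] at hD'

lemma measure_ext_of_cylinder [IsFiniteMeasure m] [IsFiniteMeasure m']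
    (h : ∀ a n, m (PiNat.cylinder a (n + 1)) = m' (PiNat.cylinder a (n + 1))) : m = m' := by
  have hfam : IsProjectiveMeasureFamily (α := fun _ : ℕ => S) (fun I => m'.map I.restrict) := by
    intro I J hJI
    rw [Measure.map_map (Finset.measurable_restrict₂ hJI) (Finset.measurable_restrict I)]
    rfl
  have hm : IsProjectiveLimit m (α := fun _ : ℕ => S) (fun I => m'.map I.restrict) :=
    (isProjectiveLimit_nat_iff' hfam m 0).2 fun n _ => map_frestrictLe_eq_of_cylinder (h · n)
  exact hm.unique fun _ => rfl

end PathSpace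

namespace StochasticMatrix

section MarkovLaw

variable {S : Type*} [MeasurableSpace S]

/-- The trajectories distributed according to `m` make transitions with the probabilities `P`,
whatever the past and the distribution of the first state. The measure `m` need not have mass `1`:
the restriction of a law to a past event is allowed. -/
def IsMarkovLaw (P : StochasticMatrix S) (m : Measure (ℕ → S)) : Prop :=
  ∀ (a : ℕ → S) (n : ℕ),
    m (PiNat.cylinder a (n + 2)) =
      ENNReal.ofReal (P.entry (a (n + 1)) (a n)) * m (PiNat.cylinder a (n + 1))

variable {P : StochasticMatrix S} {m m' : Measure (ℕ → S)}

lemma IsMarkovLaw.measure_cylinder_inter_next (hm : P.IsMarkovLaw m) (a : ℕ → S) (n : ℕ) (r : S) :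
    m (PiNat.cylinder a (n + 1) ∩ {x | x (n + 1) = r}) =
      ENNReal.ofReal (P.entry r (a n)) * m (PiNat.cylinder a (n + 1)) := by
  classical
  have hcyl : PiNat.cylinder (Function.update a (n + 1) r) (n + 1) = PiNat.cylinder a (n + 1) := by
    ext x
    refine forall₂_congr fun i hi => ?_
    rw [Function.update_of_ne hi.ne]
  have h := hm (Function.update a (n + 1) r) n
  rwa [cylinder_succ_eq_inter, hcyl, Function.update_self,
    Function.update_of_ne (Nat.lt_succ_self n).ne] at h

variable [DiscreteMeasurableSpace S]

lemma stepKernel_singleton (P : StochasticMatrix S) (s r : S) :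
    P.stepKernel s {r} = ENNReal.ofReal (P.entry r s) := by
  change (P.col s).toMeasure {r} = _
  rw [PMF.toMeasure_apply_singleton _ _ (.of_discrete)]
  rfl

variable [Countable S]

lemma IsMarkovLaw.measure_inter_next (hm : P.IsMarkovLaw m) {n : ℕ} {D : Set (ℕ → S)} {q : S}
    (hD : DependsOn (· ∈ D) (Set.Iic n)) (hq : ∀ x ∈ D, x n = q) (r : S) :
    m (D ∩ {x | x (n + 1) = r}) = ENNReal.ofReal (P.entry r q) * m D := by
  have hcyl : ∀ a : ℕ → S,
      m.restrict ({x | x n = q} ∩ {x | x (n + 1) = r}) (PiNat.cylinder a (n + 1)) =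
        (ENNReal.ofReal (P.entry r q) • m.restrict {x | x n = q}) (PiNat.cylinder a (n + 1)) := by
    intro a
    rw [Measure.restrict_apply (measurableSet_cylinder a n), Measure.smul_apply,
      Measure.restrict_apply (measurableSet_cylinder a n), ← Set.inter_assoc, smul_eq_mul]
    by_cases ha : a n = q
    · have hsub : PiNat.cylinder a (n + 1) ∩ {x | x n = q} = PiNat.cylinder a (n + 1) :=
        Set.inter_eq_left.2 fun x hx => (hx n n.lt_succ_self).trans ha
      rw [hsub, hm.measure_cylinder_inter_next, ha]
    · have hempty : PiNat.cylinder a (n + 1) ∩ {x | x n = q} = ∅ :=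
        Set.eq_empty_of_forall_notMem fun x ⟨hx, hxq⟩ => ha ((hx n n.lt_succ_self).symm.trans hxq)
      rw [hempty, Set.empty_inter, measure_empty, mul_zero]
  have h := measure_eq_of_cylinder hcyl hD
  have hDq : D ∩ {x | x n = q} = D := Set.inter_eq_left.2 hq
  have hDm := measurableSet_of_dependsOn hD
  rwa [Measure.restrict_apply hDm, Measure.smul_apply, Measure.restrict_apply hDm,
    ← Set.inter_assoc, hDq, smul_eq_mul] at h

lemma IsMarkovLaw.map_shift_restrict (hm : P.IsMarkovLaw m) {n : ℕ} {D : Set (ℕ → S)}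
    (hD : DependsOn (· ∈ D) (Set.Iic n)) : P.IsMarkovLaw ((m.restrict D).map shift^[n]) := by
  intro a k
  have hshift : Measurable (shift^[n] : (ℕ → S) → ℕ → S) := measurable_shift.iterate n
  have hE : DependsOn (· ∈ shift^[n] ⁻¹' PiNat.cylinder a (k + 1) ∩ D) (Set.Iic (n + k)) := by
    intro x y hxy
    have hx : shift^[n] x ∈ PiNat.cylinder a (k + 1) ↔ shift^[n] y ∈ PiNat.cylinder a (k + 1) := by
      refine forall₂_congr fun i hi => ?_
      rw [iterate_shift_apply, iterate_shift_apply, hxy (i + n) (Set.mem_Iic.2 (by omega))]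
    exact propext (and_congr hx
      (hD fun i hi => hxy i ((Set.mem_Iic.1 hi).trans (Nat.le_add_right n k))).to_iff)
  have hnext : shift^[n] ⁻¹' PiNat.cylinder a (k + 2) ∩ D =
      shift^[n] ⁻¹' PiNat.cylinder a (k + 1) ∩ D ∩ {x | x (n + k + 1) = a (k + 1)} := by
    rw [cylinder_succ_eq_inter, Set.preimage_inter, Set.inter_right_comm]
    congr 1
    ext x
    simp only [Set.mem_preimage, Set.mem_ofPred_eq, iterate_shift_apply]
    rw [Nat.add_comm n k, Nat.add_right_comm]
  rw [Measure.map_apply hshift (measurableSet_cylinder a (k + 1)),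
    Measure.map_apply hshift (measurableSet_cylinder a k),
    Measure.restrict_apply (hshift (measurableSet_cylinder a (k + 1))),
    Measure.restrict_apply (hshift (measurableSet_cylinder a k)), hnext]
  refine hm.measure_inter_next hE (fun x hx => ?_) _
  have hxk : shift^[n] x k = a k := hx.1 k k.lt_succ_self
  rwa [iterate_shift_apply, Nat.add_comm] at hxk

lemma IsMarkovLaw.map_eval_one (hm : P.IsMarkovLaw m) :
    m.map (fun x => x 1) = P.stepKernel ∘ₘ m.map (fun x => x 0) := by
  refine Measure.ext_of_singleton fun r => ?_
  have h0 : Measurable fun x : ℕ → S => x 0 := measurable_pi_apply 0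
  have hterm : ∀ q, m ({x | x 0 = q} ∩ {x | x 1 = r}) =
      P.stepKernel q {r} * m.map (fun x => x 0) {q} := fun q => by
    rw [Measure.map_apply h0 (measurableSet_singleton q), stepKernel_singleton]
    refine hm.measure_inter_next (n := 0) (fun x y hxy => ?_) (fun x hx => hx) r
    exact congrArg (· = q) (hxy 0 Set.self_mem_Iic)
  rw [Measure.map_apply (measurable_pi_apply 1) (measurableSet_singleton r),
    Measure.bind_apply (measurableSet_singleton r) P.stepKernel.aemeasurable, lintegral_countable',
    ← tsum_congr hterm]
  refine (tsum_measure_inter_preimage_singleton m (measurableSet_eval_mem 1 {r}) h0).symm.trans ?_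
  exact tsum_congr fun q => congrArg m (Set.inter_comm _ _)

lemma IsMarkovLaw.map_eval_succ_restrict (hm : P.IsMarkovLaw m) {n : ℕ} {D : Set (ℕ → S)}
    (hD : DependsOn (· ∈ D) (Set.Iic n)) :
    (m.restrict D).map (fun x => x (n + 1)) =
      P.stepKernel ∘ₘ (m.restrict D).map (fun x => x n) := by
  have h := (hm.map_shift_restrict hD).map_eval_one
  rw [Measure.map_map (measurable_pi_apply _) (measurable_shift.iterate n),
    Measure.map_map (measurable_pi_apply _) (measurable_shift.iterate n)] at h
  simpa only [Function.comp_def, iterate_shift_apply, Nat.add_comm 1, Nat.zero_add] using h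

lemma IsMarkovLaw.ext [IsFiniteMeasure m] [IsFiniteMeasure m'] (hm : P.IsMarkovLaw m)
    (hm' : P.IsMarkovLaw m') (h0 : m.map (fun x => x 0) = m'.map (fun x => x 0)) : m = m' := by
  refine measure_ext_of_cylinder fun a n => ?_
  induction n with
  | zero =>
    have h := congrArg (fun ν => ν {a 0}) h0
    simp only [Measure.map_apply (measurable_pi_apply 0) (measurableSet_singleton _)] at h
    rwa [cylinder_succ_eq_inter, PiNat.cylinder_zero, Set.univ_inter]
  | succ n ih => rw [hm, hm', ih]

lemma IsMarkovLaw.bind {α : Type*} [MeasurableSpace α] {κ : Kernel α (ℕ → S)}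
    (hκ : ∀ b, P.IsMarkovLaw (κ b)) (ν : Measure α) : P.IsMarkovLaw (κ ∘ₘ ν) := by
  intro a n
  rw [Measure.bind_apply (measurableSet_cylinder a (n + 1)) κ.aemeasurable,
    Measure.bind_apply (measurableSet_cylinder a n) κ.aemeasurable,
    ← lintegral_const_mul _ (κ.measurable_coe (measurableSet_cylinder a n))]
  exact lintegral_congr fun b => hκ b a n

lemma isMarkovLaw_lawFrom (P : StochasticMatrix S) (s : S) : P.IsMarkovLaw (P.lawFrom s) := by
  intro a n
  have hpair : PiNat.cylinder a (n + 2) =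
      (fun x : ℕ → S => (Preorder.frestrictLe (π := fun _ => S) n x, x (n + 1))) ⁻¹'
        ({Preorder.frestrictLe n a} ×ˢ {a (n + 1)}) := by
    rw [cylinder_succ_eq_inter, cylinder_succ_eq_preimage]
    rfl
  have hmeas : Measurable
      (fun x : ℕ → S => (Preorder.frestrictLe (π := fun _ => S) n x, x (n + 1))) := by
    fun_prop
  rw [hpair, cylinder_succ_eq_preimage, lawFrom, ← Measure.map_apply hmeas (.of_discrete),
    ← Kernel.partialTraj_compProd_eq_map_traj (Nat.zero_le n),
    Measure.compProd_apply_prod (.of_discrete) (.of_discrete), lintegral_singleton,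
    ← Kernel.traj_map_frestrictLe_apply,
    Measure.map_apply (by fun_prop) (measurableSet_singleton _), ← stepKernel_singleton]
  rfl

end MarkovLaw

end StochasticMatrix

namespace StochasticMatrix

section PathKernel

variable {S : Type*} [MeasurableSpace S] [DiscreteMeasurableSpace S] (P : StochasticMatrix S)

instance (s : S) : IsProbabilityMeasure (P.lawFrom s) := by
  unfold lawFrom
  infer_instance

/-- The law of the trajectory of the chain as a function of its first state. -/
noncomputable def pathKernel : Kernel S (ℕ → S) where
  toFun := P.lawFrom
  measurable' := .of_discrete

instance : IsMarkovKernel P.pathKernel :=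
  ⟨fun s => inferInstanceAs (IsProbabilityMeasure (P.lawFrom s))⟩

lemma map_eval_zero_lawFrom (s : S) : (P.lawFrom s).map (fun x => x 0) = Measure.dirac s := by
  have hstart : (P.lawFrom s).map (Preorder.frestrictLe (π := fun _ => S) 0) =
      Measure.dirac fun _ => s := by
    rw [lawFrom, Kernel.traj_map_frestrictLe_apply, Kernel.partialTraj_self, Kernel.id_apply]
  let start (p : Finset.Iic (0 : ℕ) → S) : S := p ⟨0, Finset.mem_Iic.2 le_rfl⟩
  have heval : Measurable start := measurable_pi_apply _
  have h := congrArg (Measure.map start) hstart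
  rw [Measure.map_map heval (Preorder.measurable_frestrictLe 0)] at h
  exact h.trans (Measure.map_dirac' heval _)

lemma map_eval_zero_pathKernel_comp (ν : Measure S) :
    (P.pathKernel ∘ₘ ν).map (fun x => x 0) = ν := by
  have hid : P.pathKernel.map (fun x => x 0) = Kernel.id := Kernel.ext fun s => by
    rw [Kernel.map_apply _ (measurable_pi_apply 0), Kernel.id_apply]
    exact P.map_eval_zero_lawFrom s
  rw [Measure.map_comp _ _ (measurable_pi_apply 0), hid, Measure.id_comp]

variable [Countable S] {P} {m : Measure (ℕ → S)} [IsFiniteMeasure m]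

lemma isMarkovLaw_pathKernel_comp (P : StochasticMatrix S) (ν : Measure S) :
    P.IsMarkovLaw (P.pathKernel ∘ₘ ν) :=
  IsMarkovLaw.bind (κ := P.pathKernel) P.isMarkovLaw_lawFrom ν

lemma IsMarkovLaw.eq_pathKernel_comp (hm : P.IsMarkovLaw m) :
    m = P.pathKernel ∘ₘ m.map (fun x => x 0) :=
  hm.ext (P.isMarkovLaw_pathKernel_comp _) (P.map_eval_zero_pathKernel_comp _).symm

lemma IsMarkovLaw.map_shift_restrict_eq (hm : P.IsMarkovLaw m) {n : ℕ} {D : Set (ℕ → S)}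
    (hD : DependsOn (· ∈ D) (Set.Iic n)) :
    (m.restrict D).map shift^[n] = P.pathKernel ∘ₘ (m.restrict D).map (fun x => x n) := by
  rw [(hm.map_shift_restrict hD).eq_pathKernel_comp,
    Measure.map_map (measurable_pi_apply 0) (measurable_shift.iterate n)]
  simp only [Function.comp_def, iterate_shift_apply, Nat.zero_add]

lemma IsMarkovLaw.measure_inter_preimage_shift (hm : P.IsMarkovLaw m) {n : ℕ} {D C : Set (ℕ → S)}
    {r : S} (hD : DependsOn (· ∈ D) (Set.Iic n)) (hr : ∀ x ∈ D, x n = r) (hC : MeasurableSet C) :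
    m (D ∩ shift^[n] ⁻¹' C) = m D * P.lawFrom r C := by
  have hshift : Measurable (shift^[n] : (ℕ → S) → ℕ → S) := measurable_shift.iterate n
  have hstate : (m.restrict D).map (fun x => x n) = m D • Measure.dirac r := by
    rw [Measure.map_congr (g := fun _ => r) ?_, Measure.map_const, Measure.restrict_apply_univ]
    exact (ae_restrict_mem (measurableSet_of_dependsOn hD)).mono hr
  have h := congrArg (fun ν => ν C) (hm.map_shift_restrict_eq hD)
  simp only [hstate, Measure.map_apply hshift hC, Measure.restrict_apply (hshift hC)] at h
  rw [Set.inter_comm, h, Measure.bind_apply hC P.pathKernel.aemeasurable, lintegral_smul_measure,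
    lintegral_dirac]
  rfl

lemma IsMarkovLaw.map_shift (hm : P.IsMarkovLaw m) :
    m.map shift = P.pathKernel ∘ₘ (P.stepKernel ∘ₘ m.map (fun x => x 0)) := by
  have huniv (n : ℕ) : DependsOn (· ∈ (Set.univ : Set (ℕ → S))) (Set.Iic n) := fun _ _ _ => rfl
  have hone := hm.map_shift_restrict_eq (huniv 1)
  have hstep := hm.map_eval_one
  rwa [Measure.restrict_univ, hstep, Function.iterate_one] at hone

lemma measurePreserving_shift {ν : Measure S} [IsFiniteMeasure ν]
    (hν : P.stepKernel.Invariant ν) :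
    MeasurePreserving shift (P.pathKernel ∘ₘ ν) (P.pathKernel ∘ₘ ν) := by
  refine ⟨measurable_shift, ?_⟩
  rw [(P.isMarkovLaw_pathKernel_comp ν).map_shift, map_eval_zero_pathKernel_comp, hν.def]

end PathKernel

end StochasticMatrix

section Chain

variable {Ω : Type*} [MeasurableSpace Ω] {μ : Measure Ω} [IsFiniteMeasure μ] {S : Type*}
  [MeasurableSpace S] [DiscreteMeasurableSpace S] [Countable S] {X : ℕ → Ω → S}
  {P : StochasticMatrix S}

lemma IsMarkovChain.isMarkovLaw_map (hX : IsMarkovChain μ X P) :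
    P.IsMarkovLaw (μ.map fun ω n => X n ω) := by
  intro a n
  have hpath : Measurable fun ω n => X n ω := measurable_pi_lambda _ hX.measurable
  have hcyl : (fun ω n => X n ω) ⁻¹' PiNat.cylinder a (n + 1) = {ω | ∀ i ≤ n, X i ω = a i} :=
    Set.ext fun ω => forall_congr' fun i => imp_congr_left Nat.lt_succ_iff
  have hpast : MeasurableSet {ω | ∀ i ≤ n, X i ω = a i} :=
    hcyl ▸ hpath (measurableSet_cylinder a n)
  rw [Measure.map_apply hpath (measurableSet_cylinder a _),
    Measure.map_apply hpath (measurableSet_cylinder a _),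
    cylinder_succ_eq_inter a (n + 1), Set.preimage_inter, hcyl]
  rcases eq_or_ne (μ {ω | ∀ i ≤ n, X i ω = a i}) 0 with h0 | h0
  · rw [h0, mul_zero]
    exact measure_mono_null Set.inter_subset_left h0
  · have h1 : μ {ω | X n ω = a n} ≠ 0 := fun h =>
      h0 (measure_mono_null (fun ω hω => hω n le_rfl) h)
    rw [← hX.transition n (a n) _ h1, ← hX.markov n a _ h0]
    exact (cond_mul_eq_inter hpast _ _).symm

end Chain

section FirstReturn

variable {S : Type*} {s : S} {x : ℕ → S}

/-- The first time `n ≥ 1` at which the trajectory `x` is at `s`, or `0` if there is none. -/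
noncomputable def firstReturn (s : S) (x : ℕ → S) : ℕ := sInf {n | 1 ≤ n ∧ x n = s}

/-- The trajectories that do not return to `s` at any of the times `1, …, n`. -/
def avoiding (s : S) (n : ℕ) : Set (ℕ → S) := {x | ∀ k, 1 ≤ k → k ≤ n → x k ≠ s}

/-- The trajectory seen from its first return to `s` on. -/
noncomputable def afterReturn (s : S) : (ℕ → S) → ℕ → S := inducedMap shift (firstReturn s)

/-- The value of `Z` at a trajectory that returns to `s` is determined by the trajectory up to its
first return. -/
def DependsOnExcursion {β : Type*} (s : S) (Z : (ℕ → S) → β) : Prop :=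
  ∀ ⦃x y⦄, firstReturn s x ≠ 0 → (∀ i ≤ firstReturn s x, x i = y i) → Z x = Z y

lemma firstReturn_eq_succ_iff {n : ℕ} :
    firstReturn s x = n + 1 ↔ x ∈ avoiding s n ∧ x (n + 1) = s := by
  constructor
  · intro h
    have hne : {n | 1 ≤ n ∧ x n = s}.Nonempty := Nat.nonempty_of_sInf_eq_succ h
    have hmem := Nat.sInf_mem hne
    rw [← firstReturn, h] at hmem
    refine ⟨fun k h1 hk hs => ?_, hmem.2⟩
    have hle : firstReturn s x ≤ k := Nat.sInf_le ⟨h1, hs⟩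
    omega
  · rintro ⟨havoid, hs⟩
    refine le_antisymm (Nat.sInf_le ⟨n.succ_pos, hs⟩) (le_csInf ⟨_, n.succ_pos, hs⟩ ?_)
    rintro k ⟨h1, hk⟩
    by_contra! hkn
    exact havoid k h1 (Nat.lt_succ_iff.1 hkn) hk

lemma firstReturn_eq_zero_iff : firstReturn s x = 0 ↔ ∀ n, x ∈ avoiding s n := by
  constructor
  · rintro h n k h1 - hk
    rcases Nat.sInf_eq_zero.1 h with h0 | hempty
    · exact absurd h0.1 (by decide)
    · exact hempty.le ⟨h1, hk⟩
  · intro h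
    by_contra hne
    obtain ⟨k, hk⟩ := Nat.exists_eq_succ_of_ne_zero hne
    exact h (k + 1) (k + 1) k.succ_pos le_rfl (firstReturn_eq_succ_iff.1 hk).2

lemma mem_avoiding_iff_lt_firstReturn (hx : firstReturn s x ≠ 0) {n : ℕ} :
    x ∈ avoiding s n ↔ n < firstReturn s x := by
  obtain ⟨k, hk⟩ := Nat.exists_eq_succ_of_ne_zero hx
  have hreturn := firstReturn_eq_succ_iff.1 hk
  constructor
  · intro hn
    by_contra! hle
    exact hn _ (Nat.one_le_iff_ne_zero.2 hx) hle (hk ▸ hreturn.2)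
  · exact fun hn j h1 hj => hreturn.1 j h1 (by omega)

lemma natCast_firstReturn_le_firstPassage (s : S) (x : ℕ → S) :
    (firstReturn s x : ℝ≥0∞) ≤ firstPassage s x :=
  le_iInf₂ fun n hn => by
    exact_mod_cast (Nat.sInf_le (s := {n | 1 ≤ n ∧ x n = s}) hn).trans n.le_succ

lemma firstPassage_eq_top (h : firstReturn s x = 0) : firstPassage s x = ∞ :=
  iInf₂_eq_top.2 fun n hn => absurd hn.2 (firstReturn_eq_zero_iff.1 h n n hn.1 le_rfl)

lemma dependsOn_avoiding (s : S) (n : ℕ) : DependsOn (· ∈ avoiding s n) (Set.Iic n) :=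
  fun _ _ hxy => propext (forall₃_congr fun k _ hk => by rw [hxy k hk])

lemma avoiding_zero (s : S) : avoiding s 0 = Set.univ :=
  Set.eq_univ_of_forall fun _ _ h1 h0 => absurd (h1.trans h0) (by decide)

lemma avoiding_eq_union (s : S) (n : ℕ) :
    avoiding s n = avoiding s (n + 1) ∪ firstReturn s ⁻¹' {n + 1} := by
  have hsucc (x : ℕ → S) : x ∈ avoiding s (n + 1) ↔ x ∈ avoiding s n ∧ x (n + 1) ≠ s :=
    ⟨fun h => ⟨fun k h1 hk => h k h1 (hk.trans n.le_succ), h (n + 1) n.succ_pos le_rfl⟩,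
      fun h k h1 hk => (Nat.le_succ_iff.1 hk).elim (h.1 k h1) fun hk => hk ▸ h.2⟩
  ext x
  rw [Set.mem_union, hsucc, Set.mem_preimage, Set.mem_singleton_iff, firstReturn_eq_succ_iff,
    ← and_or_left, and_iff_left (em' _)]

lemma disjoint_avoiding_firstReturn_eq (s : S) (n : ℕ) :
    Disjoint (avoiding s (n + 1)) (firstReturn s ⁻¹' {n + 1}) :=
  Set.disjoint_left.2 fun _ havoid hn =>
    havoid (n + 1) n.succ_pos le_rfl (firstReturn_eq_succ_iff.1 hn).2

lemma dependsOnExcursion_firstReturn (s : S) : DependsOnExcursion s (firstReturn s) := by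
  intro x y hx hxy
  obtain ⟨n, hn⟩ := Nat.exists_eq_succ_of_ne_zero hx
  obtain ⟨havoid, hs⟩ := firstReturn_eq_succ_iff.1 hn
  rw [hn, eq_comm, firstReturn_eq_succ_iff, ← hxy (n + 1) hn.ge]
  exact ⟨(dependsOn_avoiding s n fun i hi => hxy i (by have := Set.mem_Iic.1 hi; omega)).mp havoid,
    hs⟩

lemma dependsOnExcursion_inducedSum (s : S) (g : S → ℝ) :
    DependsOnExcursion s (inducedSum shift (firstReturn s) fun x => g (x 0)) := by
  intro x y hx hxy
  rw [inducedSum, inducedSum, ← dependsOnExcursion_firstReturn s hx hxy]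
  refine Finset.sum_congr rfl fun j hj => ?_
  simp only [iterate_shift_apply]
  rw [hxy _ (by have := Finset.mem_range.1 hj; omega)]

lemma dependsOn_inter_firstReturn_eq {B : Set (ℕ → S)} (hB : DependsOnExcursion s (· ∈ B)) {n : ℕ}
    (hn : n ≠ 0) : DependsOn (· ∈ B ∩ firstReturn s ⁻¹' {n}) (Set.Iic n) := by
  have himp : ∀ ⦃x y : ℕ → S⦄, (∀ i ∈ Set.Iic n, x i = y i) →
      x ∈ B ∩ firstReturn s ⁻¹' {n} → y ∈ B ∩ firstReturn s ⁻¹' {n} := by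
    rintro x y hxy ⟨hxB, rfl⟩
    exact ⟨(hB hn hxy).mp hxB, (dependsOnExcursion_firstReturn s hn hxy).symm⟩
  exact fun x y hxy => propext ⟨himp hxy, himp fun i hi => (hxy i hi).symm⟩

variable [MeasurableSpace S] [DiscreteMeasurableSpace S] [Countable S]

lemma measurableSet_avoiding (s : S) (n : ℕ) : MeasurableSet (avoiding s n) :=
  measurableSet_of_dependsOn (dependsOn_avoiding s n)

lemma measurable_firstReturn (s : S) : Measurable (firstReturn s) := by
  refine measurable_to_countable' fun n => ?_
  rcases n with - | n
  · have : firstReturn s ⁻¹' {0} = ⋂ n, avoiding s n := by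
      ext x
      simp [firstReturn_eq_zero_iff]
    rw [this]
    exact .iInter fun n => measurableSet_avoiding s n
  · have : firstReturn s ⁻¹' {n + 1} = avoiding s n ∩ {x | x (n + 1) ∈ ({s} : Set S)} :=
      Set.ext fun x => firstReturn_eq_succ_iff (n := n)
    rw [this]
    exact (measurableSet_avoiding s n).inter (measurableSet_eval_mem _ _)

lemma measurable_afterReturn (s : S) : Measurable (afterReturn s) :=
  measurable_apply_of_countable (measurable_firstReturn s) measurable_shift.iterate

end FirstReturn

section Visit

variable {S : Type*}

/-- The `0`-`1`-valued indicator of a trajectory starting in `A`; its Birkhoff averages along the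
shift are the frequencies of the visits to `A`. -/
noncomputable def visit (A : Set S) (x : ℕ → S) : ℝ := A.indicator 1 (x 0)

lemma visit_nonneg (A : Set S) : 0 ≤ visit A := fun _ =>
  Set.indicator_nonneg (fun _ _ => zero_le_one) _

lemma norm_visit_le_one (A : Set S) (x : ℕ → S) : ‖visit A x‖ ≤ 1 := by
  rw [Real.norm_of_nonneg (visit_nonneg A x)]
  exact Set.indicator_le_self' (fun _ _ => zero_le_one) _

lemma ofReal_visit (A : Set S) (x : ℕ → S) : ENNReal.ofReal (visit A x) = A.indicator 1 (x 0) := by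
  classical
  simp only [visit, Set.indicator_apply, Pi.one_apply]
  split_ifs
  · exact ENNReal.ofReal_one
  · exact ENNReal.ofReal_zero

lemma ofReal_inducedSum_visit (s : S) (A : Set S) (x : ℕ → S) :
    ENNReal.ofReal (inducedSum shift (firstReturn s) (visit A) x) =
      inducedSum shift (firstReturn s) (fun x => A.indicator 1 (x 0)) x := by
  rw [inducedSum, birkhoffSum, ENNReal.ofReal_sum_of_nonneg fun _ _ => visit_nonneg A _]
  exact Finset.sum_congr rfl fun _ _ => ofReal_visit A _

lemma inducedSum_visit_univ (s : S) :
    inducedSum shift (firstReturn s) (visit Set.univ) = fun x => (firstReturn s x : ℝ) := by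
  ext x
  simp only [inducedSum, birkhoffSum, visit, Set.indicator_univ, Pi.one_apply, Finset.sum_const,
    Finset.card_range, nsmul_one]

/-- Along the trajectory `x`, the set `A` is visited with asymptotic frequency `l`. -/
def HasFrequency (A : Set S) (l : ℝ) (x : ℕ → S) : Prop :=
  Tendsto (birkhoffAverage ℝ shift (visit A) · x) atTop (𝓝 l)

lemma hasFrequency_shift_iff {A : Set S} {l : ℝ} {x : ℕ → S} :
    HasFrequency A l (shift x) ↔ HasFrequency A l x := by
  have hbdd : Bornology.IsBounded (Set.range (visit A)) :=
    isBounded_iff_forall_norm_le.2 ⟨1, Set.forall_mem_range.2 (norm_visit_le_one A)⟩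
  have h := tendsto_birkhoffAverage_apply_sub_birkhoffAverage' ℝ hbdd shift x
  exact ⟨fun hx => by simpa [HasFrequency] using hx.sub h,
    fun hx => by simpa [HasFrequency] using hx.add h⟩

variable [MeasurableSpace S] [DiscreteMeasurableSpace S]

lemma measurable_visit (A : Set S) : Measurable (visit A) :=
  (Measurable.of_discrete (f := A.indicator (1 : S → ℝ))).comp (measurable_pi_apply 0)

lemma measurableSet_hasFrequency (A : Set S) (l : ℝ) : MeasurableSet {x | HasFrequency A l x} :=
  measurableSet_tendsto _ (measurable_birkhoffAverage measurable_shift (measurable_visit A))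

lemma integral_visit (A : Set S) (m : Measure (ℕ → S)) :
    ∫ x, visit A x ∂m = (m.map fun x => x 0).real A := by
  rw [← integral_indicator_one MeasurableSet.of_discrete, integral_map]
  · rfl
  · exact (measurable_pi_apply 0).aemeasurable
  · exact Measurable.of_discrete.aestronglyMeasurable

lemma measurable_inducedSum_visit [Countable S] (s : S) (A : Set S) :
    Measurable (inducedSum shift (firstReturn s) (visit A)) :=
  measurable_apply_of_countable (g := fun n x => birkhoffSum shift (visit A) n x)
    (measurable_firstReturn s) fun _ => Finset.measurable_sum _ fun k _ =>
      (measurable_visit A).comp (measurable_shift.iterate k)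

end Visit

namespace StochasticMatrix

variable {S : Type*} [MeasurableSpace S] [DiscreteMeasurableSpace S]
  {P : StochasticMatrix S} {s : S}

section Recurrence

/-- The state `s` is recurrent: the chain started at `s` almost surely returns to `s`. -/
def IsRecurrentAt (P : StochasticMatrix S) (s : S) : Prop :=
  ∀ᵐ x ∂P.lawFrom s, firstReturn s x ≠ 0

/-- The mean number of visits to each state during an excursion of the chain from `s`. -/
noncomputable def excursionMeasure (P : StochasticMatrix S) (s : S) : Measure S :=
  .sum fun j => ((P.lawFrom s).restrict (avoiding s j)).map fun x => x j

namespace IsRecurrentAt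

variable (hs : P.IsRecurrentAt s)
include hs

lemma measure_firstReturn_eq_zero : P.lawFrom s (firstReturn s ⁻¹' {0}) = 0 :=
  measure_mono_null (fun _ hx => not_not.2 hx) (ae_iff.1 hs)

variable [Countable S]

lemma tsum_measure_firstReturn_eq_succ :
    ∑' n : ℕ, P.lawFrom s (firstReturn s ⁻¹' {n + 1}) = 1 := by
  have hsum := tsum_measure_inter_preimage_singleton (P.lawFrom s) .univ (measurable_firstReturn s)
  simp only [Set.univ_inter, measure_univ] at hsum
  rwa [tsum_eq_zero_add' ENNReal.summable, hs.measure_firstReturn_eq_zero, zero_add] at hsum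

lemma measure_inter_preimage_afterReturn {B C : Set (ℕ → S)} (hBm : MeasurableSet B)
    (hB : DependsOnExcursion s (· ∈ B)) (hC : MeasurableSet C) :
    P.lawFrom s (B ∩ afterReturn s ⁻¹' C) = P.lawFrom s B * P.lawFrom s C := by
  have hterm (n : ℕ) : P.lawFrom s (B ∩ afterReturn s ⁻¹' C ∩ firstReturn s ⁻¹' {n}) =
      P.lawFrom s (B ∩ firstReturn s ⁻¹' {n}) * P.lawFrom s C := by
    rcases n with - | n
    · rw [measure_mono_null Set.inter_subset_right hs.measure_firstReturn_eq_zero,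
        measure_mono_null Set.inter_subset_right hs.measure_firstReturn_eq_zero, zero_mul]
    · have hshift : B ∩ afterReturn s ⁻¹' C ∩ firstReturn s ⁻¹' {n + 1} =
          B ∩ firstReturn s ⁻¹' {n + 1} ∩ shift^[n + 1] ⁻¹' C := by
        rw [Set.inter_right_comm]
        ext x
        refine and_congr_right fun hx => ?_
        rw [Set.mem_preimage, afterReturn, inducedMap, hx.2, Set.mem_preimage]
      rw [hshift]
      exact (P.isMarkovLaw_lawFrom s).measure_inter_preimage_shift
        (dependsOn_inter_firstReturn_eq hB n.succ_ne_zero)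
        (fun x hx => (firstReturn_eq_succ_iff.1 hx.2).2) hC
  rw [← tsum_measure_inter_preimage_singleton _ (hBm.inter (measurable_afterReturn s hC))
    (measurable_firstReturn s), tsum_congr hterm, ENNReal.tsum_mul_right,
    tsum_measure_inter_preimage_singleton _ hBm (measurable_firstReturn s)]

lemma measurePreserving_afterReturn :
    MeasurePreserving (afterReturn s) (P.lawFrom s) (P.lawFrom s) := by
  refine ⟨measurable_afterReturn s, Measure.ext fun C hC => ?_⟩
  rw [Measure.map_apply (measurable_afterReturn s) hC, ← Set.univ_inter (afterReturn s ⁻¹' C),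
    hs.measure_inter_preimage_afterReturn .univ (fun _ _ _ _ => rfl) hC, measure_univ, one_mul]

lemma indepFun_afterReturn {β : Type*} [MeasurableSpace β] {Z : (ℕ → S) → β} (hZm : Measurable Z)
    (hZ : DependsOnExcursion s Z) : IndepFun Z (afterReturn s) (P.lawFrom s) := by
  refine indepFun_iff_measure_inter_preimage_eq_mul.2 fun B C hB hC => ?_
  have hZB : DependsOnExcursion s (· ∈ Z ⁻¹' B) := fun x y hx hxy =>
    congrArg (· ∈ B) (hZ hx hxy)
  rw [hs.measure_inter_preimage_afterReturn (hZm hB) hZB hC,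
    hs.measurePreserving_afterReturn.measure_preimage hC.nullMeasurableSet]

lemma lintegral_excursionMeasure (g : S → ℝ≥0∞) :
    ∫⁻ r, g r ∂P.excursionMeasure s =
      ∫⁻ x, inducedSum shift (firstReturn s) (fun x => g (x 0)) x ∂P.lawFrom s := by
  have hterm (j : ℕ) : ∫⁻ r, g r ∂((P.lawFrom s).restrict (avoiding s j)).map (fun x => x j) =
      ∫⁻ x, (avoiding s j).indicator (fun x => g (x j)) x ∂P.lawFrom s := by
    rw [lintegral_map .of_discrete (measurable_pi_apply j),
      lintegral_indicator (measurableSet_avoiding s j)]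
  have hmeas (j : ℕ) :
      AEMeasurable ((avoiding s j).indicator fun x => g (x j)) (P.lawFrom s) :=
    ((Measurable.of_discrete (f := g)).comp (measurable_pi_apply j)).aemeasurable.indicator
      (measurableSet_avoiding s j)
  rw [excursionMeasure, lintegral_sum_measure, tsum_congr hterm, ← lintegral_tsum hmeas]
  refine lintegral_congr_ae (hs.mono fun x hx => ?_)
  dsimp only
  rw [inducedSum, birkhoffSum, tsum_eq_sum (s := Finset.range (firstReturn s x)) fun j hj => ?_]
  · refine Finset.sum_congr rfl fun j hj => ?_
    rw [Set.indicator_of_mem ((mem_avoiding_iff_lt_firstReturn hx).2 (Finset.mem_range.1 hj)),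
      iterate_shift_apply, Nat.zero_add]
  · exact Set.indicator_of_notMem
      (fun h => hj (Finset.mem_range.2 ((mem_avoiding_iff_lt_firstReturn hx).1 h))) _

lemma excursionMeasure_real (A : Set S) : (P.excursionMeasure s).real A =
    ∫ x, inducedSum shift (firstReturn s) (visit A) x ∂P.lawFrom s := by
  rw [integral_eq_lintegral_of_nonneg_ae (ae_of_all _ (inducedSum_nonneg (visit_nonneg A)))
      (measurable_inducedSum_visit s A).aestronglyMeasurable,
    lintegral_congr (ofReal_inducedSum_visit s A), ← hs.lintegral_excursionMeasure,
    lintegral_indicator_one .of_discrete, Measure.real]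

lemma excursionMeasure_univ :
    P.excursionMeasure s Set.univ = ∫⁻ x, firstReturn s x ∂P.lawFrom s := by
  rw [← lintegral_one, hs.lintegral_excursionMeasure]
  refine lintegral_congr fun x => ?_
  rw [inducedSum, birkhoffSum, Finset.sum_const, Finset.card_range, nsmul_one]

-- Moving an excursion one step forward replaces its initial visit to `s` by its final one.
lemma invariant_excursionMeasure : P.stepKernel.Invariant (P.excursionMeasure s) := by
  have hstep (j : ℕ) : P.stepKernel ∘ₘ ((P.lawFrom s).restrict (avoiding s j)).map (fun x => x j) =
      ((P.lawFrom s).restrict (avoiding s (j + 1))).map (fun x => x (j + 1)) +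
        P.lawFrom s (firstReturn s ⁻¹' {j + 1}) • Measure.dirac s := by
    rw [← (P.isMarkovLaw_lawFrom s).map_eval_succ_restrict (dependsOn_avoiding s j),
      avoiding_eq_union, Measure.restrict_union (disjoint_avoiding_firstReturn_eq s j)
        (measurable_firstReturn s (measurableSet_singleton _)),
      Measure.map_add _ _ (measurable_pi_apply _)]
    congr 1
    rw [Measure.map_congr (g := fun _ => s), Measure.map_const, Measure.restrict_apply_univ]
    exact (ae_restrict_mem (measurable_firstReturn s (measurableSet_singleton _))).mono
      fun x hx => (firstReturn_eq_succ_iff.1 hx).2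
  ext A hA
  rw [excursionMeasure, Measure.bind_sum _ _ P.stepKernel.aemeasurable, Measure.sum_apply _ hA,
    Measure.sum_apply _ hA, tsum_eq_zero_add' (f := fun j =>
      ((P.lawFrom s).restrict (avoiding s j)).map (fun x => x j) A) ENNReal.summable, avoiding_zero,
    Measure.restrict_univ, map_eval_zero_lawFrom]
  simp only [hstep, Measure.add_apply, Measure.smul_apply, smul_eq_mul]
  rw [ENNReal.tsum_add, ENNReal.tsum_mul_right, hs.tsum_measure_firstReturn_eq_succ, one_mul,
    add_comm]

end IsRecurrentAt

end Recurrence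

section PositiveRecurrence

/-- The state `s` is positive recurrent: the chain started at `s` returns to `s` after a time of
finite mean. -/
def IsPositiveRecurrentAt (P : StochasticMatrix S) (s : S) : Prop :=
  ∫⁻ x, firstPassage s x ∂P.lawFrom s < ∞

/-- The mean proportion of an excursion from `s` that the chain spends in each state. -/
noncomputable def excursionDistribution (P : StochasticMatrix S) (s : S) : Measure S :=
  (P.excursionMeasure s Set.univ)⁻¹ • P.excursionMeasure s

namespace IsPositiveRecurrentAt

variable [Countable S] (hs : P.IsPositiveRecurrentAt s)
include hs

lemma isRecurrentAt : P.IsRecurrentAt s := by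
  have hmeas : MeasurableSet (firstReturn s ⁻¹' {0}) :=
    measurable_firstReturn s (measurableSet_singleton 0)
  have hle : ∞ * P.lawFrom s (firstReturn s ⁻¹' {0}) ≤ ∫⁻ x, firstPassage s x ∂P.lawFrom s := by
    rw [← lintegral_indicator_const hmeas]
    refine lintegral_mono fun x => Set.indicator_apply_le' (fun hx => ?_) fun _ => zero_le
    exact (firstPassage_eq_top hx).ge
  refine measure_mono_null (t := firstReturn s ⁻¹' {0}) (fun x hx => not_not.1 hx) ?_
  by_contra hne
  rw [ENNReal.top_mul hne] at hle
  exact hs.not_ge hle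

lemma isFiniteMeasure_excursionMeasure : IsFiniteMeasure (P.excursionMeasure s) := by
  refine ⟨hs.isRecurrentAt.excursionMeasure_univ.trans_lt (lt_of_le_of_lt ?_ hs)⟩
  exact lintegral_mono fun x => natCast_firstReturn_le_firstPassage s x

lemma excursionMeasure_ne_zero : P.excursionMeasure s ≠ 0 := by
  have hmeas : Measurable fun x => (firstReturn s x : ℝ≥0∞) :=
    measurable_from_top.comp (measurable_firstReturn s)
  rw [Ne, ← Measure.measure_univ_eq_zero, hs.isRecurrentAt.excursionMeasure_univ,
    lintegral_eq_zero_iff hmeas]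
  intro h0
  obtain ⟨x, hx, hx0⟩ := (hs.isRecurrentAt.and h0).exists
  exact hx (Nat.cast_eq_zero.1 hx0)

lemma isProbabilityMeasure_excursionDistribution :
    IsProbabilityMeasure (P.excursionDistribution s) :=
  have := hs.isFiniteMeasure_excursionMeasure
  have : NeZero (P.excursionMeasure s) := ⟨hs.excursionMeasure_ne_zero⟩
  isProbabilityMeasureSMul

lemma invariant_excursionDistribution : P.stepKernel.Invariant (P.excursionDistribution s) := by
  rw [Kernel.Invariant, excursionDistribution, Measure.bind_smul,
    hs.isRecurrentAt.invariant_excursionMeasure.def]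

lemma integrable_inducedSum_visit (A : Set S) :
    Integrable (inducedSum shift (firstReturn s) (visit A)) (P.lawFrom s) := by
  have := hs.isFiniteMeasure_excursionMeasure
  refine ⟨(measurable_inducedSum_visit s A).aestronglyMeasurable, ?_⟩
  rw [hasFiniteIntegral_iff_ofReal (ae_of_all _ (inducedSum_nonneg (visit_nonneg A))),
    lintegral_congr (ofReal_inducedSum_visit s A), ← hs.isRecurrentAt.lintegral_excursionMeasure,
    lintegral_indicator_one .of_discrete]
  exact measure_lt_top _ _

lemma ae_tendsto_birkhoffAverage_inducedSum (A : Set S) :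
    ∀ᵐ x ∂P.lawFrom s, Tendsto
      (birkhoffAverage ℝ (afterReturn s) (inducedSum shift (firstReturn s) (visit A)) · x) atTop
      (𝓝 ((P.excursionMeasure s).real A)) := by
  have hmeas := measurable_inducedSum_visit s A
  rw [hs.isRecurrentAt.excursionMeasure_real]
  exact strong_law_birkhoffAverage hs.isRecurrentAt.measurePreserving_afterReturn hmeas
    (hs.integrable_inducedSum_visit A) (hs.isRecurrentAt.indepFun_afterReturn hmeas
      (dependsOnExcursion_inducedSum s (A.indicator 1)))

lemma ae_hasFrequency (A : Set S) :
    ∀ᵐ x ∂P.lawFrom s, HasFrequency A ((P.excursionDistribution s).real A) x := by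
  have := hs.isFiniteMeasure_excursionMeasure
  have : NeZero (P.excursionMeasure s) := ⟨hs.excursionMeasure_ne_zero⟩
  have hfreq : (P.excursionDistribution s).real A =
      (P.excursionMeasure s).real A / (P.excursionMeasure s).real Set.univ := by
    rw [excursionDistribution, measureReal_ennreal_smul_apply, ENNReal.toReal_inv, inv_mul_eq_div,
      Measure.real, Measure.real]
  rw [hfreq]
  filter_upwards [hs.ae_tendsto_birkhoffAverage_inducedSum A,
    hs.ae_tendsto_birkhoffAverage_inducedSum Set.univ] with x hvisits hlength
  rw [inducedSum_visit_univ] at hlength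
  exact tendsto_birkhoffAverage_of_inducedMap (visit_nonneg A) measureReal_univ_pos hlength hvisits

end IsPositiveRecurrentAt

end PositiveRecurrence

section Accessible

/-- The state `s` can be reached from `r` along transitions of positive probability. -/
def Accessible (P : StochasticMatrix S) (r s : S) : Prop :=
  Relation.ReflTransGen (fun a b => 0 < P.entry b a) r s

variable [Countable S]

lemma ae_lawFrom_of_ae_shift {p : (ℕ → S) → Prop} (hp : MeasurableSet {x | p x})
    (hs : ∀ᵐ x ∂P.lawFrom s, p (shift x)) {r : S} (hr : 0 < P.entry r s) :
    ∀ᵐ x ∂P.lawFrom r, p x := by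
  have hshift := (ae_map_iff measurable_shift.aemeasurable hp).2 hs
  rw [(P.isMarkovLaw_lawFrom s).map_shift, map_eval_zero_lawFrom, Measure.dirac_bind
    P.stepKernel.measurable] at hshift
  refine ae_iff_of_countable.1 (Measure.ae_ae_of_ae_comp hshift) r ?_
  rw [stepKernel_singleton]
  exact (ENNReal.ofReal_pos.2 hr).ne'

lemma Accessible.ae_hasFrequency {A : Set S} {l : ℝ} {r : S} (hrs : P.Accessible r s)
    (hr : ∀ᵐ x ∂P.lawFrom r, HasFrequency A l x) : ∀ᵐ x ∂P.lawFrom s, HasFrequency A l x := by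
  induction hrs with
  | refl => exact hr
  | tail _ hstep ih =>
    refine ae_lawFrom_of_ae_shift (measurableSet_hasFrequency A l) ?_ hstep
    exact ih.mono fun x hx => hasFrequency_shift_iff.2 hx

end Accessible

end StochasticMatrix

lemma hasSum_ofReal_iff {ι : Type*} {f : ι → ℝ} {a : ℝ} (hf : ∀ i, 0 ≤ f i) (ha : 0 ≤ a) :
    HasSum (fun i => ENNReal.ofReal (f i)) (ENNReal.ofReal a) ↔ HasSum f a := by
  simp only [ENNReal.ofReal]
  rw [ENNReal.hasSum_coe, ← NNReal.hasSum_coe]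
  simp only [Real.coe_toNNReal _ (hf _), Real.coe_toNNReal a ha]

section Stationary

variable {S : Type*} [MeasurableSpace S] [DiscreteMeasurableSpace S] {P : StochasticMatrix S}

lemma StochasticMatrix.IsStationary.exists_measure {π : S → ℝ} (hπ : P.IsStationary π) :
    ∃ ν : Measure S, IsProbabilityMeasure ν ∧ π = fun s => ν.real {s} := by
  have hsum : HasSum (fun s => ENNReal.ofReal (π s)) 1 := by
    rw [← ENNReal.ofReal_one, hasSum_ofReal_iff hπ.nonneg zero_le_one]
    exact hπ.hasSum_one
  let p : PMF S := ⟨_, hsum⟩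
  refine ⟨p.toMeasure, inferInstance, funext fun s => ?_⟩
  rw [Measure.real, PMF.toMeasure_apply_singleton _ _ .of_discrete]
  exact (ENNReal.toReal_ofReal (hπ.nonneg s)).symm

variable [Countable S] {ν : Measure S}

lemma hasSum_measureReal_singleton [IsFiniteMeasure ν] (A : Set S) :
    HasSum (fun s : A => ν.real {(s : S)}) (ν.real A) := by
  rw [← hasSum_ofReal_iff (fun _ => measureReal_nonneg) measureReal_nonneg]
  simp only [ofReal_measureReal (measure_ne_top ν _)]
  rw [ENNReal.summable.hasSum_iff]
  exact tsum_measure_preimage_singleton (f := id) A.to_countable fun _ _ => .of_discrete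

namespace StochasticMatrix

lemma isStationary_iff_invariant [IsProbabilityMeasure ν] :
    P.IsStationary (fun s => ν.real {s}) ↔ P.stepKernel.Invariant ν := by
  have hflow (r : S) : HasSum (fun s => P.entry r s * ν.real {s}) (ν.real {r}) ↔
      (P.stepKernel ∘ₘ ν) {r} = ν {r} := by
    rw [← hasSum_ofReal_iff (fun s => mul_nonneg (P.nonneg r s) measureReal_nonneg)
      measureReal_nonneg, Measure.bind_apply .of_discrete P.stepKernel.aemeasurable,
      lintegral_countable', ofReal_measureReal, ENNReal.summable.hasSum_iff]
    simp only [ENNReal.ofReal_mul (P.nonneg r _), ofReal_measureReal (measure_ne_top ν _),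
      stepKernel_singleton]
  constructor
  · exact fun h => Measure.ext_of_singleton fun r => (hflow r).1 (h.invariant r)
  · refine fun h => ⟨fun _ => measureReal_nonneg, ?_, fun r => (hflow r).2 (by rw [h.def])⟩
    have hsum := hasSum_measureReal_singleton (ν := ν) Set.univ
    rw [probReal_univ] at hsum
    exact (Equiv.Set.univ S).hasSum_iff.1 hsum

lemma measureReal_eq_of_ae_hasFrequency [IsProbabilityMeasure ν] (hν : P.stepKernel.Invariant ν)
    {A : Set S} {l : ℝ} (h : ∀ s, ∀ᵐ x ∂P.lawFrom s, HasFrequency A l x) : ν.real A = l := by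
  have hae : ∀ᵐ x ∂P.pathKernel ∘ₘ ν, HasFrequency A l x :=
    Measure.ae_comp_of_ae_ae (measurableSet_hasFrequency A l) (ae_of_all _ h)
  have hint := integral_eq_of_ae_tendsto_birkhoffAverage (measurePreserving_shift hν)
    (measurable_visit A) (norm_visit_le_one A) hae
  rwa [integral_visit, map_eval_zero_pathKernel_comp] at hint

lemma IsStationary.eq_of_ae_hasFrequency {π : S → ℝ} (hπ : P.IsStationary π)
    (h : ∀ A s, ∀ᵐ x ∂P.lawFrom s, HasFrequency A (ν.real A) x) : π = fun r => ν.real {r} := by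
  obtain ⟨ν', _, rfl⟩ := hπ.exists_measure
  exact funext fun r =>
    measureReal_eq_of_ae_hasFrequency (isStationary_iff_invariant.1 hπ) (h {r})

end StochasticMatrix

end Stationary

section DeadlineMissRate

variable {Ω : Type*} {S : Type*} {X : ℕ → Ω → S} {missed : ℕ → Set Ω}

lemma DMRUpTo_eq_birkhoffAverage {A : Set S} (hmissed : ∀ j ω, ω ∈ missed j ↔ X j ω ∈ A) (N : ℕ)
    (ω : Ω) : DMRUpTo missed N ω = birkhoffAverage ℝ shift (visit A) N fun n => X n ω := by
  classical
  rw [DMRUpTo, birkhoffAverage, birkhoffSum, one_div, smul_eq_mul]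
  refine congrArg _ (Finset.sum_congr rfl fun j _ => ?_)
  simp only [DM, visit, iterate_shift_apply, Nat.zero_add, Set.indicator_apply, hmissed,
    Pi.one_apply]

variable [MeasurableSpace Ω] {μ : Measure Ω}

lemma IsDeadlineMissRate.iff_eq [NeZero μ] {d d₀ : ℝ} (h₀ : IsDeadlineMissRate μ missed d₀) :
    IsDeadlineMissRate μ missed d ↔ d = d₀ := by
  refine ⟨fun h => ?_, fun h => h ▸ h₀⟩
  obtain ⟨ω, hω, hω₀⟩ := (h.and h₀).exists
  exact tendsto_nhds_unique hω hω₀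

variable [MeasurableSpace S] [DiscreteMeasurableSpace S] [Countable S] {P : StochasticMatrix S}

lemma IsMarkovChain.ae_of_forall_ae_lawFrom [IsFiniteMeasure μ] (hX : IsMarkovChain μ X P)
    {p : (ℕ → S) → Prop} (hp : MeasurableSet {x | p x}) (h : ∀ s, ∀ᵐ x ∂P.lawFrom s, p x) :
    ∀ᵐ ω ∂μ, p fun n => X n ω := by
  refine ae_of_ae_map (measurable_pi_lambda _ hX.measurable).aemeasurable ?_
  rw [hX.isMarkovLaw_map.eq_pathKernel_comp]
  exact Measure.ae_comp_of_ae_ae hp (ae_of_all _ h)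

lemma IsMarkovChain.isDeadlineMissRate [IsFiniteMeasure μ] (hX : IsMarkovChain μ X P) {A : Set S}
    (hmissed : ∀ j ω, ω ∈ missed j ↔ X j ω ∈ A) {d : ℝ}
    (h : ∀ s, ∀ᵐ x ∂P.lawFrom s, HasFrequency A d x) : IsDeadlineMissRate μ missed d := by
  filter_upwards [hX.ae_of_forall_ae_lawFrom (measurableSet_hasFrequency A d) h] with ω hω
  exact hω.congr fun N => (DMRUpTo_eq_birkhoffAverage hmissed N ω).symm

end DeadlineMissRate

end DeadlineMiss

theorem theorem2_general {Ω : Type*} [MeasurableSpace Ω] (μ : Measure Ω) [IsProbabilityMeasure μ]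
    {S : Type*} [Countable S] [MeasurableSpace S] [DiscreteMeasurableSpace S]
    (P : DeadlineMiss.StochasticMatrix S) (X : ℕ → Ω → S)
    (hX : DeadlineMiss.IsMarkovChain μ X P)
    (s₀ : S) (hacc : ∀ s, P.Accessible s₀ s) (hrec : P.IsPositiveRecurrentAt s₀)
    (SDM : Set S) (missed : ℕ → Set Ω)
    (hmissed : ∀ (j : ℕ) (ω : Ω), ω ∈ missed j ↔ X j ω ∈ SDM) :
    ∃ π : S → ℝ, P.IsStationary π ∧ (∀ π' : S → ℝ, P.IsStationary π' → π' = π) ∧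
      (∀ᵐ ω ∂μ, Tendsto (fun N : ℕ => DeadlineMiss.DMRUpTo missed N ω) atTop
        (𝓝 (∑' s : SDM, π s))) ∧
      (∀ d : ℝ, DeadlineMiss.IsDeadlineMissRate μ missed d ↔ d = ∑' s : SDM, π s) := by
  set ν := P.excursionDistribution s₀
  have : IsProbabilityMeasure ν := hrec.isProbabilityMeasure_excursionDistribution
  have hfreq (A : Set S) (s : S) : ∀ᵐ x ∂P.lawFrom s, DeadlineMiss.HasFrequency A (ν.real A) x :=
    (hacc s).ae_hasFrequency (hrec.ae_hasFrequency A)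
  have hrate : DeadlineMiss.IsDeadlineMissRate μ missed (ν.real SDM) :=
    hX.isDeadlineMissRate hmissed (hfreq SDM)
  rw [← (DeadlineMiss.hasSum_measureReal_singleton SDM).tsum_eq] at hrate
  exact ⟨fun r => ν.real {r},
    DeadlineMiss.StochasticMatrix.isStationary_iff_invariant.2 hrec.invariant_excursionDistribution,
    fun π hπ => hπ.eq_of_ae_hasFrequency hfreq, hrate, fun d => hrate.iff_eq⟩

theorem theorem2 {Ω : Type*} [MeasurableSpace Ω] (μ : Measure Ω) [IsProbabilityMeasure μ]
    {S : Type*} [Countable S] [MeasurableSpace S] [DiscreteMeasurableSpace S]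
    (P : DeadlineMiss.StochasticMatrix S) (X : ℕ → Ω → S)
    (hX : DeadlineMiss.IsMarkovChain μ X P)
    (hirr : P.IsIrreducible) (hrec : P.IsPositiveRecurrent)
    (SDM : Set S) (missed : ℕ → Set Ω)
    (hmissed : ∀ (j : ℕ) (ω : Ω), ω ∈ missed j ↔ X j ω ∈ SDM) :
    ∃ π : S → ℝ, P.IsStationary π ∧ (∀ π' : S → ℝ, P.IsStationary π' → π' = π) ∧
      (∀ᵐ ω ∂μ, Tendsto (fun N : ℕ => DeadlineMiss.DMRUpTo missed N ω) atTop
        (𝓝 (∑' s : SDM, π s))) ∧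
      (∀ d : ℝ, DeadlineMiss.IsDeadlineMissRate μ missed d ↔ d = ∑' s : SDM, π s) := by
  obtain ⟨ω₀⟩ : Nonempty Ω := μ.nonempty_of_neZero
  exact theorem2_general μ P X hX (X 0 ω₀) (fun s => (hirr _ s).to_reflTransGen) (hrec _) SDM
    missed hmissed
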